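/- Let $d\ge 0$ be an integer, $T\ge 0$, and let $p,q\in(1,\infty)$ satisfy $\frac{2}{q}+\frac{d}{p}=2$. For a measure space $(X,\mu)$ and a measurable function $g$ on $X$, let $$\|g\|_{L^{q,1}(X)} = q\int_0^\infty t\,\mu(|g|\ge t)^{1/q}\,\frac{dt}{t}$$ be the Lorentz quasi-norm. Let $f:[0,T]\times\mathbb{R}^d\to\mathbb{R}$ be a measurable function in $L^{q,1}([0,T],L^p_x)$, i.e. such that the function $t\mapsto \|f(t,\cdot)\|_{L^p(\mathbb{R}^d)}$ has finite $L^{q,1}([0,T])$ quasi-norm. For each $x\in\mathbb{R}^d$ let $B^x$ be a $d$-dimensional Brownian motion starting from $x$. Then, for every $x\in\mathbb{R}^d$, almost surely the function $s\mapsto f(s,B^x_s)$ is integrable on $[0,T]$, the integral $\int_0^T f(s,B^x_s)\,ds$ is (up to a null set) a random variable, and $$\sup_{x\in\mathbb{R}^d}\mathbb{E}\exp\Big(\int_0^T f(s,B^x_s)\,ds\Big)<\infty .$$ -/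

import Mathlib

open MeasureTheory ProbabilityTheory Set
open scoped ENNReal NNReal

/-- The measure `dt / t` on the half line `(0, ∞)`. -/
noncomputable def haarHalfLine : Measure ℝ :=
  (volume.restrict (Ioi (0 : ℝ))).withDensity fun t => ENNReal.ofReal t⁻¹

/-- The Lorentz quasi-norm
`‖g‖_{L^{q,r}(X, μ)} = q^{1/r} ‖ t μ(|g| ≥ t)^{1/q} ‖_{L^r((0, ∞), dt / t)}`
for `0 < q < ∞` and `0 < r ≤ ∞` (with `1 / ∞ = 0`), with values in `[0, ∞]`. -/
noncomputable def lorentzENorm {X ε : Type*} [MeasurableSpace X] [ENorm ε]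
    (g : X → ε) (q : ℝ) (r : ℝ≥0∞) (μ : Measure X) : ℝ≥0∞ :=
  ENNReal.ofReal q ^ (1 / r.toReal) *
    eLpNorm (fun t : ℝ => ENNReal.ofReal t * μ {x | ENNReal.ofReal t ≤ ‖g x‖ₑ} ^ (1 / q))
      r haarHalfLine

/-- `f ∈ L^{q,r}([0, T], L^p(ℝ^d))`: the function `f` is (almost everywhere) measurable on
`[0, T] × ℝ^d`, and `t ↦ ‖f(t, ·)‖_{L^p(ℝ^d)}` has finite `L^{q,r}([0, T])` quasi-norm. -/
structure MemMixedLorentz {d : ℕ} (f : ℝ → EuclideanSpace ℝ (Fin d) → ℝ)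
    (q : ℝ) (r : ℝ≥0∞) (p : ℝ) (T : ℝ) : Prop where
  aemeasurable : AEMeasurable (Function.uncurry f)
    ((volume.restrict (Icc (0 : ℝ) T)).prod volume)
  lorentzENorm_lt_top :
    lorentzENorm (fun t : ℝ => eLpNorm (f t) (ENNReal.ofReal p) volume) q r
      (volume.restrict (Icc (0 : ℝ) T)) < ∞

/-- `B` is a `d`-dimensional Brownian motion started at `x`: the coordinates of `B - x` are
independent standard real Brownian motions (with almost surely continuous paths). -/
structure IsBrownianFrom {d : ℕ} {Ω : Type*} [MeasurableSpace Ω]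
    (x : EuclideanSpace ℝ (Fin d)) (B : ℝ≥0 → Ω → EuclideanSpace ℝ (Fin d))
    (P : Measure Ω) : Prop where
  isBrownianReal_coord : ∀ i, IsBrownianReal (fun t ω => B t ω i - x i) P
  iIndepFun_coord : iIndepFun (fun (i : Fin d) (ω : Ω) (t : ℝ≥0) => B t ω i) P

/-! The argument is Khasminskii's. If the expectation of `∫ₜᵀ h(r, W_{r-t}) dr` is at most `α` for
all starting times and points, the Markov property applied inside an iterated time integral bounds
the `n`-th moment by `n! αⁿ`; summing the exponential series gives `(1 - α)⁻¹`
(`khasminskii_moment`, `khasminskii_exp`).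

To verify the hypothesis, Jensen and the heat kernel bound give `E h(r, W_{r-t}) ≤ (r-t)^(-d/(2p))
‖h(r)‖_p` (`IsContBrownian.lintegral_comp_le`). The relation between `p` and `q` turns this exponent
into `1/q - 1`, a weight in weak `L^{q'}`, `q'` conjugate to `q`, so duality with `L^{q,1}` bounds
the time integral by the Lorentz norm (`lintegral_rpow_sub_mul_le`).

That norm need not be small, but it is absolutely continuous: keeping only the values with `|f| > M`
makes it arbitrarily small as `M → ∞` (`exists_truncation_khasminskii`). The values below `M` cost a
factor of at most `exp(M T)`. All bounds are uniform in the starting point. -/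

/-- A Brownian motion started at `x`, all of whose paths are continuous and all of whose
marginals are measurable (not only almost everywhere). -/
structure IsContBrownian {d : ℕ} {Ω : Type*} [MeasurableSpace Ω]
    (x : EuclideanSpace ℝ (Fin d)) (B : ℝ≥0 → Ω → EuclideanSpace ℝ (Fin d))
    (P : Measure Ω) : Prop extends IsBrownianFrom x B P where
  measurable : ∀ t, Measurable (B t)
  continuous : ∀ ω, Continuous fun t => B t ω

/-! ### Brownian paths: regular versions, Markov property, heat kernel bound -/

section BrownianPaths

variable {d : ℕ} {Ω : Type*} [MeasurableSpace Ω] {x : EuclideanSpace ℝ (Fin d)}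
  {B B' : ℝ≥0 → Ω → EuclideanSpace ℝ (Fin d)} {P : Measure Ω}

lemma IsBrownianFrom.isProbabilityMeasure (hB : IsBrownianFrom x B P) :
    IsProbabilityMeasure P := hB.iIndepFun_coord.isProbabilityMeasure

lemma IsBrownianFrom.congr (hB : IsBrownianFrom x B P) (h : ∀ᵐ ω ∂P, ∀ t, B t ω = B' t ω) :
    IsBrownianFrom x B' P where
  isBrownianReal_coord i := by
    refine ⟨(hB.isBrownianReal_coord i).toIsPreBrownianReal.congr fun t => ?_, ?_⟩
    · filter_upwards [h] with ω hω using by simp [hω t]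
    · filter_upwards [h, (hB.isBrownianReal_coord i).cont] with ω hω hc
      simpa [hω] using hc
  iIndepFun_coord := by
    refine hB.iIndepFun_coord.congr fun i => ?_
    filter_upwards [h] with ω hω
    simp [hω]

lemma IsBrownianFrom.aemeasurable (hB : IsBrownianFrom x B P) (t : ℝ≥0) :
    AEMeasurable (B t) P := by
  have h : AEMeasurable (fun ω i => B t ω i) P := aemeasurable_pi_lambda _ fun i => by
    simpa using ((hB.isBrownianReal_coord i).aemeasurable t).add_const (x i)
  exact (WithLp.measurable_toLp 2 (Fin d → ℝ)).comp_aemeasurable h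

lemma IsBrownianFrom.ae_continuous (hB : IsBrownianFrom x B P) :
    ∀ᵐ ω ∂P, Continuous fun t => B t ω := by
  filter_upwards [ae_all_iff.2 fun i => (hB.isBrownianReal_coord i).cont] with ω hω
  have h : Continuous fun t => (fun i => B t ω i) := continuous_pi fun i => by
    exact ((hω i).add (continuous_const (y := x i))).congr fun t => by simp
  exact (PiLp.continuous_toLp 2 (fun _ : Fin d => ℝ)).comp h

/-- Every Brownian motion is indistinguishable from one with continuous paths and measurable
marginals. -/
lemma IsBrownianFrom.exists_isContBrownian (hB : IsBrownianFrom x B P) :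
    ∃ B', IsContBrownian x B' P ∧ ∀ᵐ ω ∂P, ∀ t, B t ω = B' t ω := by
  -- Countably many times suffice: marginals are corrected at the times `u n` off a single null set,
  -- and continuity gives measurability at the other times as a limit.
  obtain ⟨u, hu⟩ := TopologicalSpace.exists_dense_seq ℝ≥0
  have hgood : ∀ᵐ ω ∂P, Continuous (fun t => B t ω) ∧
      ∀ n, B (u n) ω = (hB.aemeasurable (u n)).mk _ ω :=
    hB.ae_continuous.and (ae_all_iff.2 fun n => (hB.aemeasurable (u n)).ae_eq_mk)
  set N : Set Ω := toMeasurable P {ω | ¬ (Continuous (fun t => B t ω) ∧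
      ∀ n, B (u n) ω = (hB.aemeasurable (u n)).mk _ ω)} with hN
  have hNm : MeasurableSet N := measurableSet_toMeasurable _ _
  have hN0 : P N = 0 := by rw [hN, measure_toMeasurable]; exact hgood
  have hNgood : ∀ ω ∉ N, Continuous (fun t => B t ω) ∧
      ∀ n, B (u n) ω = (hB.aemeasurable (u n)).mk _ ω := by
    intro ω hω
    by_contra hcon
    exact hω (subset_toMeasurable _ _ hcon)
  classical
  let B' : ℝ≥0 → Ω → EuclideanSpace ℝ (Fin d) := fun t ω => if ω ∈ N then x else B t ω
  have hae : ∀ᵐ ω ∂P, ∀ t, B t ω = B' t ω := by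
    have : ∀ᵐ ω ∂P, ω ∉ N := measure_eq_zero_iff_ae_notMem.1 hN0
    filter_upwards [this] with ω hω t
    simp [B', hω]
  have hcont : ∀ ω, Continuous fun t => B' t ω := by
    intro ω
    by_cases hω : ω ∈ N
    · simpa [B', hω] using continuous_const
    · simpa [B', hω] using (hNgood ω hω).1
  have hmu : ∀ n, Measurable (B' (u n)) := by
    intro n
    have : B' (u n) = fun ω => if ω ∈ N then x else (hB.aemeasurable (u n)).mk _ ω := by
      funext ω
      by_cases hω : ω ∈ N
      · simp [B', hω]
      · simp [B', hω, (hNgood ω hω).2 n]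
    rw [this]
    exact Measurable.ite hNm measurable_const (hB.aemeasurable (u n)).measurable_mk
  refine ⟨B', ⟨hB.congr hae, fun t => ?_, hcont⟩, hae⟩
  obtain ⟨v, hv, hvt⟩ := mem_closure_iff_seq_limit.1 (hu t)
  choose k hk using hv
  refine measurable_of_tendsto_metrizable (fun n => hmu (k n)) (tendsto_pi_nhds.2 fun ω => ?_)
  simp only [hk]
  exact ((hcont ω).tendsto t).comp hvt

lemma IsContBrownian.measurable_uncurry (hB : IsContBrownian x B P) :
    Measurable (Function.uncurry B) :=
  measurable_uncurry_of_continuous_of_measurable hB.continuous hB.measurable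

lemma iIndepFun_bool {β : Type*} [MeasurableSpace β] {X : Bool → Ω → β}
    (h : IndepFun (X true) (X false) P) (hP : IsProbabilityMeasure P) : iIndepFun X P := by
  classical
  rw [iIndepFun_iff_measure_inter_preimage_eq_mul]
  intro S s hs
  rw [indepFun_iff_measure_inter_preimage_eq_mul] at h
  have ht := h (if true ∈ S then s true else univ) (if false ∈ S then s false else univ)
    (by split_ifs with h1 <;> simp_all) (by split_ifs with h1 <;> simp_all)
  by_cases h1 : true ∈ S <;> by_cases h2 : false ∈ S
  · have : S = {true, false} := by ext b; cases b <;> simp_all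
    subst this
    rw [Finset.set_biInter_insert, Finset.set_biInter_singleton, Finset.prod_pair (by simp)]
    simpa using ht
  · have : S = {true} := by ext b; cases b <;> simp_all
    subst this; simp
  · have : S = {false} := by ext b; cases b <;> simp_all
    subst this; simp
  · have : S = ∅ := by ext b; cases b <;> simp_all
    subst this; simp

/-- The Markov property: an increment process restarted from a deterministic point is again a
Brownian motion. -/
lemma IsContBrownian.shift (hB : IsContBrownian x B P) (s : ℝ≥0) (y : EuclideanSpace ℝ (Fin d)) :
    IsContBrownian y (fun t ω => y + (B (s + t) ω - B s ω)) P where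
  isBrownianReal_coord i := by
    have := (hB.isBrownianReal_coord i).shift s
    simpa using this
  iIndepFun_coord := by
    refine hB.iIndepFun_coord.comp (fun i w t => y i + (w (s + t) - w s)) fun i => ?_
    fun_prop
  measurable t := measurable_const.add ((hB.measurable _).sub (hB.measurable _))
  continuous ω := by
    have := hB.continuous ω
    fun_prop

/-- Independence across coordinates and, within each coordinate, between position and later
increments combine into independence over all pairs; these are then regrouped by time instead of by
coordinate. -/
lemma IsContBrownian.indepFun_shift (hB : IsContBrownian x B P) (s : ℝ≥0) :
    IndepFun (B s) (fun ω t => B (s + t) ω - B s ω) P := by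
  classical
  have := hB.isProbabilityMeasure
  have hBi : ∀ t i, Measurable fun ω => B t ω i := fun t i =>
    (measurable_pi_apply i).comp ((WithLp.measurable_ofLp 2 (Fin d → ℝ)).comp (hB.measurable t))
  -- `true` selects the increments after `s`; `false` selects the position at `s`, as a constant
  -- path so that both have the same codomain.
  let φ : Bool → (ℝ≥0 → ℝ) → (ℝ≥0 → ℝ) := fun b w t => if b then w (s + t) - w s else w s
  have hφ : ∀ b, Measurable (φ b) := by
    intro b
    refine measurable_pi_lambda _ fun t => ?_
    cases b <;> simp only [φ, Bool.false_eq_true, if_true, if_false] <;> fun_prop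
  let X : Fin d → Bool → Ω → (ℝ≥0 → ℝ) := fun i b ω => φ b fun t => B t ω i
  have hX : ∀ i b, Measurable (X i b) := fun i b =>
    (hφ b).comp (measurable_pi_lambda _ fun t => hBi t i)
  have h1 : iIndepFun (fun i ω => (X i · ω)) P :=
    hB.iIndepFun_coord.comp (fun i w b => φ b w) fun i => measurable_pi_lambda _ hφ
  have h2 : ∀ i, iIndepFun (X i) P := by
    intro i
    refine iIndepFun_bool ?_ this
    have h := (hB.isBrownianReal_coord i).indepFun_shift s
    have h' := h.comp (φ := fun w => w) (ψ := fun w (_ : ℝ≥0) => w ⟨s, le_refl s⟩ + x i)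
      measurable_id (by fun_prop)
    convert h' using 1
    · funext ω t; simp [X, φ]
    · funext ω t; simp [X, φ]
  have h3 := iIndepFun_uncurry' hX h1 h2
  let S : Bool → Finset (Fin d × Bool) := fun b => Finset.univ ×ˢ {b}
  have h4 := h3.indepFun_finset (S false) (S true)
    (by rw [Finset.disjoint_left]; rintro ⟨i, b⟩; simp [S])
    (fun p => hX p.1 p.2)
  have hmem : ∀ b i, (i, b) ∈ S b := by simp [S]
  have h5 := h4.comp
    (φ := fun w => (WithLp.toLp 2 fun i => w ⟨(i, false), hmem _ i⟩ 0 : EuclideanSpace ℝ (Fin d)))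
    (ψ := fun w (t : ℝ≥0) =>
      (WithLp.toLp 2 fun i => w ⟨(i, true), hmem _ i⟩ t : EuclideanSpace ℝ (Fin d)))
    (by
      refine (WithLp.measurable_toLp 2 (Fin d → ℝ)).comp (measurable_pi_lambda _ fun i => ?_)
      fun_prop)
    (by
      refine measurable_pi_lambda _ fun t =>
        (WithLp.measurable_toLp 2 (Fin d → ℝ)).comp (measurable_pi_lambda _ fun i => ?_)
      fun_prop)
  exact h5

lemma pi_le_smul_volume {ι : Type*} [Fintype ι] {μ : ι → Measure ℝ} [∀ i, SigmaFinite (μ i)]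
    {c : ℝ≥0} (h : ∀ i, μ i ≤ (c : ℝ≥0∞) • volume) :
    Measure.pi μ ≤ (c : ℝ≥0∞) ^ Fintype.card ι • (volume : Measure (ι → ℝ)) := by
  have hpi : Measure.pi (fun _ : ι => (c : ℝ≥0∞) • (volume : Measure ℝ)) =
      (c : ℝ≥0∞) ^ Fintype.card ι • (volume : Measure (ι → ℝ)) := by
    have : SigmaFinite ((c : ℝ≥0∞) • (volume : Measure ℝ)) :=
      SMul.sigmaFinite (μ := volume) c
    refine Measure.pi_eq fun s hs => ?_
    rw [Measure.smul_apply, volume_pi_pi]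
    simp [Finset.prod_mul_distrib]
  rw [← hpi]
  refine Measure.le_iff.2 fun s hs => ?_
  conv_rhs => rw [Measure.pi, toMeasure_apply _ _ hs]
  -- An inequality of measures does not extend from boxes by a π-system argument; instead
  -- `OuterMeasure.pi` is the largest outer measure with the given bounds on boxes.
  have : (Measure.pi μ).toOuterMeasure ≤
      OuterMeasure.pi fun _ : ι => ((c : ℝ≥0∞) • (volume : Measure ℝ)).toOuterMeasure := by
    rw [OuterMeasure.le_pi]
    intro t _
    change Measure.pi μ (univ.pi t) ≤ _
    rw [Measure.pi_pi]
    exact Finset.prod_le_prod' fun i _ => h i _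
  exact this s

lemma gaussianReal_le_smul_volume (m : ℝ) {v : ℝ≥0} (hv : v ≠ 0) :
    gaussianReal m v ≤ (Real.toNNReal (√(2 * Real.pi * v))⁻¹ : ℝ≥0∞) • volume := by
  rw [gaussianReal_of_var_ne_zero _ hv, ← withDensity_const]
  refine withDensity_mono (Filter.Eventually.of_forall fun y => ?_)
  refine ENNReal.ofReal_le_ofReal ?_
  rw [gaussianPDFReal]
  refine mul_le_of_le_one_right (by positivity) (Real.exp_le_one_iff.2 ?_)
  rw [neg_div]
  exact neg_nonpos.2 (by positivity)

/-- The heat kernel at time `s` is bounded by `(2 π s) ^ (- d / 2)`. -/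
lemma IsContBrownian.map_le (hB : IsContBrownian x B P) {s : ℝ≥0} (hs : s ≠ 0) :
    P.map (B s) ≤ (Real.toNNReal (√(2 * Real.pi * s))⁻¹ : ℝ≥0∞) ^ d • volume := by
  have := hB.isProbabilityMeasure
  have hBi : ∀ t i, Measurable fun ω => B t ω i := fun t i =>
    (measurable_pi_apply i).comp ((WithLp.measurable_ofLp 2 (Fin d → ℝ)).comp (hB.measurable t))
  have hind : iIndepFun (fun i ω => B s ω i) P :=
    hB.iIndepFun_coord.comp (fun _ w => w s) fun i => by fun_prop
  have hlaw : ∀ i, P.map (fun ω => B s ω i) = gaussianReal (x i) s := by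
    intro i
    have h := gaussianReal_add_const ((hB.isBrownianReal_coord i).hasLaw_eval s) (x i)
    simpa using h.map_eq
  have h1 := hind.map_fun_eq_pi_map fun i => (hBi s i).aemeasurable
  simp only [hlaw] at h1
  have h2 : P.map (B s) = (P.map fun ω i => B s ω i).map (WithLp.toLp 2) := by
    rw [Measure.map_map (WithLp.measurable_toLp 2 (Fin d → ℝ))
      (measurable_pi_lambda _ fun i => hBi s i)]
    rfl
  rw [h2, h1, ← (PiLp.volume_preserving_toLp (Fin d)).map_eq, ← Measure.map_smul]
  refine Measure.map_mono ?_ (WithLp.measurable_toLp 2 (Fin d → ℝ))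
  simpa using pi_le_smul_volume fun i => gaussianReal_le_smul_volume (x i) hs

end BrownianPaths

/-! ### Iterated time integrals and independence -/

lemma antitone_lintegral_Ioc (k : ℝ → ℝ≥0∞) (T : ℝ) :
    Antitone fun r => ∫⁻ u in Ioc r T, k u := fun _ _ h =>
  lintegral_mono_set (Ioc_subset_Ioc_left h)

lemma lintegral_lintegral_triangle {k F : ℝ → ℝ≥0∞} (hk : Measurable k) (hF : Measurable F)
    (t T : ℝ) :
    ∫⁻ r in Ioc t T, F r * ∫⁻ u in Ioc t r, k u = ∫⁻ u in Ioc t T, k u * ∫⁻ r in Ioc u T, F r := by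
  have h1 : ∫⁻ r in Ioc t T, F r * ∫⁻ u in Ioc t r, k u =
      ∫⁻ r in Ioc t T, ∫⁻ u in Ioc t T, {p : ℝ × ℝ | p.2 ≤ p.1}.indicator
        (fun p => F p.1 * k p.2) (r, u) := by
    refine setLIntegral_congr_fun measurableSet_Ioc fun r hr => ?_
    have : Ioc t r = Iic r ∩ Ioc t T := by
      ext u; simp only [mem_Ioc, mem_inter_iff, mem_Iic]; grind
    rw [← lintegral_const_mul _ hk, this, ← Measure.restrict_restrict measurableSet_Iic,
      ← lintegral_indicator measurableSet_Iic]
    rfl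
  have h2 : ∫⁻ u in Ioc t T, k u * ∫⁻ r in Ioc u T, F r =
      ∫⁻ u in Ioc t T, ∫⁻ r in Ioc t T, {p : ℝ × ℝ | p.2 ≤ p.1}.indicator
        (fun p => F p.1 * k p.2) (r, u) := by
    refine setLIntegral_congr_fun measurableSet_Ioc fun u hu => ?_
    -- The closed triangle produces `Icc u T`; the endpoint `u` is null.
    have : Icc u T = Ici u ∩ Ioc t T := by
      ext r; simp only [mem_Ioc, mem_inter_iff, mem_Icc, mem_Ici]; grind
    rw [← lintegral_const_mul _ hF, setLIntegral_congr Ioc_ae_eq_Icc, this,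
      ← Measure.restrict_restrict measurableSet_Ici, ← lintegral_indicator measurableSet_Ici]
    refine lintegral_congr fun r => ?_
    simp only [indicator, mem_Ici, mem_ofPred_eq, mul_comm]
  rw [h1, h2, lintegral_lintegral_swap]
  refine Measurable.aemeasurable (Measurable.indicator ?_ (measurableSet_le measurable_snd
    measurable_fst))
  exact (hF.comp measurable_fst).mul (hk.comp measurable_snd)

/-- `(∫ₜᵀ k) ^ (n + 1) = (n + 1) ∫ₜᵀ k(r) (∫ᵣᵀ k) ^ n dr`. -/
lemma pow_lintegral_Ioc {k : ℝ → ℝ≥0∞} (hk : Measurable k) (T : ℝ) (n : ℕ) (t : ℝ) :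
    (∫⁻ r in Ioc t T, k r) ^ (n + 1) =
      (n + 1) * ∫⁻ r in Ioc t T, k r * (∫⁻ u in Ioc r T, k u) ^ n := by
  have hI : Measurable fun r => ∫⁻ u in Ioc r T, k u := (antitone_lintegral_Ioc k T).measurable
  induction n generalizing t with
  | zero => simp
  | succ n ih =>
    have hF : Measurable fun r => k r * (∫⁻ u in Ioc r T, k u) ^ n := hk.mul (hI.pow_const n)
    -- Split the last factor at `r`: the part after `r` raises the power, and the part before `r` is
    -- handled by swapping the triangle. By induction, `n + 1` copies of the latter equal one copy
    -- of the former, giving `n + 2` in all. No differentiation is used, so infinite integrals are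
    -- allowed.
    have h1 : (∫⁻ r in Ioc t T, k r * (∫⁻ u in Ioc r T, k u) ^ n) * ∫⁻ u in Ioc t T, k u =
        (∫⁻ r in Ioc t T, k r * (∫⁻ u in Ioc r T, k u) ^ (n + 1)) +
          ∫⁻ u in Ioc t T, k u * ∫⁻ r in Ioc u T, k r * (∫⁻ u in Ioc r T, k u) ^ n := by
      rw [← lintegral_lintegral_triangle hk hF, ← lintegral_mul_const _ hF,
        ← lintegral_add_left (f := fun r => k r * (∫⁻ u in Ioc r T, k u) ^ (n + 1))
          (hk.mul (hI.pow_const _))]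
      refine setLIntegral_congr_fun measurableSet_Ioc fun r hr => ?_
      rw [pow_succ, ← mul_assoc, ← mul_add, add_comm,
        ← lintegral_union measurableSet_Ioc (Ioc_disjoint_Ioc_of_le le_rfl),
        Ioc_union_Ioc_eq_Ioc hr.1.le hr.2]
    have h2 : (n + 1) * ∫⁻ u in Ioc t T, k u * ∫⁻ r in Ioc u T, k r * (∫⁻ u in Ioc r T, k u) ^ n =
        ∫⁻ u in Ioc t T, k u * (∫⁻ r in Ioc u T, k r) ^ (n + 1) := by
      rw [← lintegral_const_mul' _ _ (by finiteness)]
      refine lintegral_congr fun u => ?_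
      rw [ih u]
      ring
    rw [pow_succ, ih t, mul_assoc, h1, mul_add, h2]
    push_cast
    ring

/-- Fubini for the product law: `X` is frozen while `V` is averaged over an independent copy. -/
lemma lintegral_prodMk_of_indepFun {Ω α β : Type*} [MeasurableSpace Ω] [MeasurableSpace α]
    [MeasurableSpace β] {P : Measure Ω} [IsFiniteMeasure P] {X : Ω → α} {V : Ω → β}
    (hX : Measurable X) (hV : Measurable V) (h : IndepFun X V P) {G : α × β → ℝ≥0∞}
    (hG : Measurable G) :
    ∫⁻ ω, G (X ω, V ω) ∂P = ∫⁻ ω, ∫⁻ ω', G (X ω, V ω') ∂P ∂P := by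
  rw [← lintegral_map (g := fun ω => (X ω, V ω)) hG (hX.prodMk hV),
    h.map_prod_eq_prod_map_map hX.aemeasurable hV.aemeasurable,
    lintegral_prod _ hG.aemeasurable, lintegral_map hG.lintegral_prod_right' hX]
  refine lintegral_congr fun ω => ?_
  exact lintegral_map (f := fun v => G (X ω, v)) (hG.comp measurable_prodMk_left) hV

/-! ### Khasminskii's lemma -/

section Khasminskii

variable {d : ℕ} {Ω : Type*} [MeasurableSpace Ω] {P : Measure Ω}
  {h : ℝ → EuclideanSpace ℝ (Fin d) → ℝ≥0∞}

lemma measurable_setLIntegral_Ioc {α : Type*} [MeasurableSpace α] {F : α → ℝ → ℝ≥0∞} (T : ℝ)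
    (hF : Measurable (Function.uncurry F)) :
    Measurable fun p : ℝ × α => ∫⁻ u in Ioc p.1 T, F p.2 u := by
  have : (fun p : ℝ × α => ∫⁻ u in Ioc p.1 T, F p.2 u) = fun p : ℝ × α => ∫⁻ u,
      {z : (ℝ × α) × ℝ | z.1.1 < z.2 ∧ z.2 ≤ T}.indicator (fun z => F z.1.2 z.2) (p, u) := by
    funext p
    rw [← lintegral_indicator measurableSet_Ioc]
    rfl
  rw [this]
  refine Measurable.lintegral_prod_right' (Measurable.indicator ?_ ?_)
  · exact hF.comp (measurable_fst.snd.prodMk measurable_snd)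
  · exact (measurableSet_lt measurable_fst.fst measurable_snd).inter
      (measurableSet_le measurable_snd measurable_const)

/-- Conditionally on the position at time `r`, the future of a Brownian motion is a Brownian motion
restarted from that position. -/
lemma IsContBrownian.lintegral_mul_pow_le {x : EuclideanSpace ℝ (Fin d)}
    {B : ℝ≥0 → Ω → EuclideanSpace ℝ (Fin d)} (hB : IsContBrownian x B P)
    (hh : Measurable (Function.uncurry h)) {t r T : ℝ} (htr : t ≤ r) (n : ℕ) {c : ℝ≥0∞}
    (hc : ∀ y, ∀ W : ℝ≥0 → Ω → EuclideanSpace ℝ (Fin d), IsContBrownian y W P →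
      ∫⁻ ω, (∫⁻ u in Ioc r T, h u (W (u - r).toNNReal ω)) ^ n ∂P ≤ c) :
    ∫⁻ ω, h r (B (r - t).toNNReal ω) * (∫⁻ u in Ioc r T, h u (B (u - t).toNNReal ω)) ^ n ∂P ≤
      c * ∫⁻ ω, h r (B (r - t).toNNReal ω) ∂P := by
  have := hB.isProbabilityMeasure
  set s := (r - t).toNNReal with hs
  -- Restricting to continuous paths makes evaluation `(v, w) ↦ w v` jointly measurable, which the
  -- time integral in `G` requires.
  let C := {w : ℝ≥0 → EuclideanSpace ℝ (Fin d) // Continuous w}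
  let V : Ω → C := fun ω => ⟨fun v => B (s + v) ω - B s ω, by
    have := hB.continuous ω
    fun_prop⟩
  have hV : Measurable V := Measurable.subtype_mk
    (measurable_pi_lambda _ fun v => (hB.measurable _).sub (hB.measurable _))
  have hind : IndepFun (B s) V P := by
    have h0 := hB.indepFun_shift s
    rw [IndepFun_iff_Indep] at h0 ⊢
    convert h0 using 1
    change MeasurableSpace.comap V (MeasurableSpace.comap Subtype.val _) = _
    rw [MeasurableSpace.comap_comp]
    rfl
  have heval : Measurable fun p : ℝ≥0 × C => p.2.1 p.1 :=
    measurable_uncurry_of_continuous_of_measurable (u := fun (v : ℝ≥0) (w : C) => w.1 v)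
      (fun w => w.2) (fun v => (measurable_pi_apply v).comp measurable_subtype_coe)
  let G : EuclideanSpace ℝ (Fin d) × C → ℝ≥0∞ := fun p =>
    h r p.1 * (∫⁻ u in Ioc r T, h u (p.1 + p.2.1 (u - r).toNNReal)) ^ n
  have hG : Measurable G := by
    refine (hh.comp (measurable_const.prodMk measurable_fst)).mul (Measurable.pow_const ?_ n)
    refine Measurable.lintegral_prod_right' (f := fun z : (EuclideanSpace ℝ (Fin d) × C) × ℝ =>
      h z.2 (z.1.1 + z.1.2.1 (z.2 - r).toNNReal)) ?_
    refine hh.comp (measurable_snd.prodMk (measurable_fst.fst.add ?_))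
    exact heval.comp ((measurable_snd.sub_const r).real_toNNReal.prodMk measurable_fst.snd)
  have h1 : ∀ ω, h r (B s ω) * (∫⁻ u in Ioc r T, h u (B (u - t).toNNReal ω)) ^ n =
      G (B s ω, V ω) := by
    intro ω
    simp only [G, V]
    congr 2
    refine setLIntegral_congr_fun measurableSet_Ioc fun u hu => ?_
    rw [hs, ← Real.toNNReal_add (by linarith) (by linarith [hu.1])]
    congr 1
    simp
  simp_rw [h1]
  rw [lintegral_prodMk_of_indepFun (hB.measurable s) hV hind hG,
    ← lintegral_const_mul (f := fun ω => h r (B s ω)) _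
      (hh.comp (measurable_const.prodMk (hB.measurable s)))]
  refine lintegral_mono fun ω => ?_
  simp only [G]
  rw [lintegral_const_mul, mul_comm]
  · gcongr
    -- With `ω` frozen, the restarted process lives on the same `(Ω, P)`, so `hc` is needed only for
    -- this space.
    exact hc _ _ (hB.shift s (B s ω))
  · refine Measurable.pow_const ?_ n
    refine Measurable.lintegral_prod_right' (f := fun z : Ω × ℝ =>
      h z.2 (B s ω + (V z.1).1 (z.2 - r).toNNReal)) ?_
    refine hh.comp (measurable_snd.prodMk (measurable_const.add ?_))
    exact heval.comp ((measurable_snd.sub_const r).real_toNNReal.prodMk (hV.comp measurable_fst))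

/-- Khasminskii's lemma, for moments. -/
theorem khasminskii_moment (hh : Measurable (Function.uncurry h)) {T : ℝ} {α : ℝ≥0∞}
    (hα : ∀ t, 0 ≤ t → ∀ x, ∀ B : ℝ≥0 → Ω → EuclideanSpace ℝ (Fin d), IsContBrownian x B P →
      ∫⁻ r in Ioc t T, ∫⁻ ω, h r (B (r - t).toNNReal ω) ∂P ≤ α) (n : ℕ) :
    ∀ t, 0 ≤ t → ∀ x, ∀ B : ℝ≥0 → Ω → EuclideanSpace ℝ (Fin d), IsContBrownian x B P →
      ∫⁻ ω, (∫⁻ r in Ioc t T, h r (B (r - t).toNNReal ω)) ^ n ∂P ≤ n.factorial * α ^ n := by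
  induction n with
  | zero =>
    intro t _ x B hB
    have := hB.isProbabilityMeasure
    simp
  | succ n ih =>
    intro t ht x B hB
    have := hB.isProbabilityMeasure
    have hm : Measurable (Function.uncurry fun ω (r : ℝ) => h r (B (r - t).toNNReal ω)) := by
      refine hh.comp (measurable_snd.prodMk (hB.measurable_uncurry.comp
        (Measurable.prodMk ?_ measurable_fst)))
      exact (measurable_snd.sub_const t).real_toNNReal
    have hI := measurable_setLIntegral_Ioc T hm
    have h1 : ∀ ω, (∫⁻ r in Ioc t T, h r (B (r - t).toNNReal ω)) ^ (n + 1) =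
        (n + 1) * ∫⁻ r in Ioc t T, h r (B (r - t).toNNReal ω) *
          (∫⁻ u in Ioc r T, h u (B (u - t).toNNReal ω)) ^ n := fun ω =>
      pow_lintegral_Ioc (hm.comp measurable_prodMk_left) T n t
    simp_rw [h1]
    rw [lintegral_const_mul' _ _ (by finiteness), lintegral_lintegral_swap]
    · calc _ ≤ (n + 1 : ℝ≥0∞) * ∫⁻ r in Ioc t T, (n.factorial * α ^ n) *
            ∫⁻ ω, h r (B (r - t).toNNReal ω) ∂P := by
            gcongr (n + 1 : ℝ≥0∞) * ?_
            refine setLIntegral_mono' measurableSet_Ioc fun r hr => ?_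
            exact hB.lintegral_mul_pow_le hh hr.1.le n (ih r (ht.trans hr.1.le))
        _ = (n + 1 : ℝ≥0∞) * ((n.factorial * α ^ n) * ∫⁻ r in Ioc t T,
            ∫⁻ ω, h r (B (r - t).toNNReal ω) ∂P) := by
            rw [lintegral_const_mul]
            exact (hm.comp measurable_swap).lintegral_prod_right'
        _ ≤ (n + 1 : ℝ≥0∞) * ((n.factorial * α ^ n) * α) := by
            gcongr
            exact hα t ht x B hB
        _ = _ := by
            rw [Nat.factorial_succ]
            push_cast
            ring
    · exact (hm.mul ((hI.comp measurable_swap).pow_const n)).aemeasurable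

lemma ENNReal.ofReal_exp_toReal {y : ℝ≥0∞} (hy : y ≠ ∞) :
    ENNReal.ofReal (Real.exp y.toReal) = ∑' n : ℕ, y ^ n / n.factorial := by
  rw [Real.exp_eq_exp_ℝ, NormedSpace.exp_eq_tsum_div, ENNReal.ofReal_tsum_of_nonneg
    (fun n => by positivity) (Real.summable_pow_div_factorial _)]
  refine tsum_congr fun n => ?_
  rw [ENNReal.ofReal_div_of_pos (by positivity), ENNReal.ofReal_pow ENNReal.toReal_nonneg,
    ENNReal.ofReal_toReal hy, ENNReal.ofReal_natCast]

/-- Khasminskii's lemma. -/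
theorem khasminskii_exp (hh : Measurable (Function.uncurry h)) {T : ℝ} {α : ℝ≥0∞}
    (hα1 : α ≠ ∞)
    (hα : ∀ t, 0 ≤ t → ∀ x, ∀ B : ℝ≥0 → Ω → EuclideanSpace ℝ (Fin d), IsContBrownian x B P →
      ∫⁻ r in Ioc t T, ∫⁻ ω, h r (B (r - t).toNNReal ω) ∂P ≤ α)
    {x : EuclideanSpace ℝ (Fin d)} {B : ℝ≥0 → Ω → EuclideanSpace ℝ (Fin d)}
    (hB : IsContBrownian x B P) :
    (∀ᵐ ω ∂P, ∫⁻ r in Ioc 0 T, h r (B r.toNNReal ω) ≠ ∞) ∧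
    ∫⁻ ω, ENNReal.ofReal (Real.exp (∫⁻ r in Ioc 0 T, h r (B r.toNNReal ω)).toReal) ∂P ≤
      (1 - α)⁻¹ := by
  have hm : Measurable (Function.uncurry fun ω (r : ℝ) => h r (B r.toNNReal ω)) :=
    hh.comp (measurable_snd.prodMk (hB.measurable_uncurry.comp
      (measurable_snd.real_toNNReal.prodMk measurable_fst)))
  have hI : Measurable fun ω => ∫⁻ r in Ioc 0 T, h r (B r.toNNReal ω) := by
    exact Measurable.lintegral_prod_right' hm
  have hmom : ∀ n : ℕ, ∫⁻ ω, (∫⁻ r in Ioc 0 T, h r (B r.toNNReal ω)) ^ n ∂P ≤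
      n.factorial * α ^ n := fun n => by
    simpa using khasminskii_moment hh hα n 0 le_rfl x B hB
  -- Since `toReal` sends `∞` to `0`, finiteness must come first; the first moment provides it.
  have hfin : ∀ᵐ ω ∂P, ∫⁻ r in Ioc 0 T, h r (B r.toNNReal ω) < ∞ := by
    refine ae_lt_top hI (ne_top_of_le_ne_top ?_ (le_trans (by simp) (hmom 1)))
    simpa using hα1
  refine ⟨hfin.mono fun ω hω => hω.ne, ?_⟩
  calc _ = ∫⁻ ω, ∑' n : ℕ, (∫⁻ r in Ioc 0 T, h r (B r.toNNReal ω)) ^ n / n.factorial ∂P := by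
        refine lintegral_congr_ae ?_
        filter_upwards [hfin] with ω hω
        exact ENNReal.ofReal_exp_toReal hω.ne
    _ = ∑' n : ℕ, ∫⁻ ω, (∫⁻ r in Ioc 0 T, h r (B r.toNNReal ω)) ^ n / n.factorial ∂P :=
        lintegral_tsum fun n => ((hI.pow_const n).div_const _).aemeasurable
    _ ≤ ∑' n : ℕ, α ^ n := by
        refine ENNReal.tsum_le_tsum fun n => ?_
        simp only [div_eq_mul_inv]
        rw [lintegral_mul_const _ (hI.pow_const n), ← div_eq_mul_inv]
        exact ENNReal.div_le_of_le_mul' (hmom n)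
    -- For `α ≥ 1` both sides are `∞`, so `α < 1` need not be assumed.
    _ = _ := ENNReal.tsum_geometric α

end Khasminskii

/-! ### Heat kernel estimate and Lorentz duality in time -/

/-- Jensen's inequality and the heat kernel bound. -/
lemma IsContBrownian.lintegral_comp_le {d : ℕ} {Ω : Type*} [MeasurableSpace Ω]
    {x : EuclideanSpace ℝ (Fin d)} {B : ℝ≥0 → Ω → EuclideanSpace ℝ (Fin d)} {P : Measure Ω}
    (hB : IsContBrownian x B P) {p : ℝ} (hp : 1 < p) {h : EuclideanSpace ℝ (Fin d) → ℝ≥0∞}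
    (hh : Measurable h) {s : ℝ} (hs : 0 < s) :
    ∫⁻ ω, h (B s.toNNReal ω) ∂P ≤
      ENNReal.ofReal (s ^ (-((d : ℝ) / p / 2))) * (∫⁻ y, h y ^ p) ^ (1 / p) := by
  have := hB.isProbabilityMeasure
  have hp0 : 0 < p := by linarith
  set c : ℝ≥0∞ := (Real.toNNReal (√(2 * Real.pi * s))⁻¹ : ℝ≥0∞) ^ d with hc
  have hcs : c ^ (1 / p) ≤ ENNReal.ofReal (s ^ (-((d : ℝ) / p / 2))) := by
    have h2 : (1 : ℝ) ≤ 2 * Real.pi := by linarith [Real.pi_gt_three]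
    have hle : (√(2 * Real.pi * s))⁻¹ ≤ s ^ (-(1 / 2 : ℝ)) := by
      rw [Real.rpow_neg hs.le, ← Real.sqrt_eq_rpow]
      exact inv_anti₀ (Real.sqrt_pos.2 hs) (Real.sqrt_le_sqrt (by nlinarith))
    calc c ^ (1 / p) ≤ (ENNReal.ofReal (s ^ (-(1 / 2 : ℝ))) ^ d) ^ (1 / p) := by
          rw [hc]
          gcongr
          exact ENNReal.ofReal_le_ofReal hle
      _ = _ := by
          rw [← ENNReal.rpow_natCast, ← ENNReal.rpow_mul,
            ENNReal.ofReal_rpow_of_pos (by positivity), ← Real.rpow_mul hs.le]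
          congr 2
          field_simp
  have hle := hB.map_le (s := s.toNNReal) (by simpa using hs)
  rw [Real.coe_toNNReal _ hs.le, ← hc] at hle
  -- Jensen's inequality as Hölder against the constant `1` on a probability space.
  have hJ : ∫⁻ ω, h (B s.toNNReal ω) ∂P ≤ (∫⁻ ω, h (B s.toNNReal ω) ^ p ∂P) ^ (1 / p) := by
    simpa using ENNReal.lintegral_mul_le_Lp_mul_Lq P (Real.HolderConjugate.conjExponent hp)
      (hh.comp (hB.measurable _)).aemeasurable (measurable_const (a := (1 : ℝ≥0∞))).aemeasurable
  calc _ ≤ (∫⁻ ω, h (B s.toNNReal ω) ^ p ∂P) ^ (1 / p) := hJ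
    _ ≤ (c * ∫⁻ y, h y ^ p) ^ (1 / p) := by
        gcongr
        rw [← lintegral_map (hh.pow_const p) (hB.measurable _), ← smul_eq_mul,
          ← lintegral_smul_measure]
        exact lintegral_mono' hle le_rfl
    _ ≤ _ := by
        rw [ENNReal.mul_rpow_of_nonneg _ _ (by positivity)]
        gcongr

lemma lintegral_Ioc_rpow_sub {b : ℝ} (hb : -1 < b) (t : ℝ) {ρ : ℝ} (hρ : 0 ≤ ρ) :
    ∫⁻ r in Ioc t (t + ρ), ENNReal.ofReal ((r - t) ^ b) =
      ENNReal.ofReal (ρ ^ (b + 1) / (b + 1)) := by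
  have hint : IntervalIntegrable (fun r : ℝ => (r - t) ^ b) volume t (t + ρ) := by
    have := (intervalIntegral.intervalIntegrable_rpow' hb (a := 0) (b := ρ)).comp_sub_right t
    simpa [add_comm] using this
  rw [← ofReal_integral_eq_lintegral_ofReal
    ((intervalIntegrable_iff_integrableOn_Ioc_of_le (by linarith)).1 hint)
    ((ae_restrict_mem measurableSet_Ioc).mono fun r hr =>
      Real.rpow_nonneg (by linarith [hr.1]) _),
    ← intervalIntegral.integral_of_le (by linarith),
    intervalIntegral.integral_comp_sub_right (fun r : ℝ => r ^ b) t]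
  rw [integral_rpow (Or.inl hb), sub_self, add_sub_cancel_left,
    Real.zero_rpow (by linarith), sub_zero]

/-- The weak-type bound for the weight `r ↦ (r - t) ^ (1 / q - 1)`. -/
lemma lintegral_rpow_sub_le {q : ℝ} (hq : 1 < q) (t : ℝ) {A : Set ℝ} (hA : MeasurableSet A)
    (hAt : A ⊆ Ioi t) :
    ∫⁻ r in A, ENNReal.ofReal ((r - t) ^ (1 / q - 1)) ≤
      ENNReal.ofReal (q + 1) * volume A ^ (1 / q) := by
  have hq0 : 0 < q := by linarith
  have hq1 : 1 / q < 1 := by rw [div_lt_one hq0]; exact hq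
  have hq2 : 0 < 1 / q := by positivity
  rcases eq_or_ne (volume A) ∞ with h | h
  · rw [h, ENNReal.top_rpow_of_pos hq2, ENNReal.mul_top (by simp; linarith)]
    exact le_top
  rcases eq_or_ne (volume A) 0 with h0 | h0
  · rw [Measure.restrict_eq_zero.2 h0]
    simp
  -- Cut at distance `ρ = |A|` from `t`. The near part contributes at most `q ρ^(1/q)`; on the far
  -- part the weight is at most `ρ^(1/q - 1)`, contributing at most `ρ^(1/q)`. Hence the constant `q
  -- + 1`.
  set ρ := (volume A).toReal with hρ
  have hρ0 : 0 < ρ := ENNReal.toReal_pos h0 h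
  have hAρ : volume A = ENNReal.ofReal ρ := (ENNReal.ofReal_toReal h).symm
  have hsub : A ⊆ Ioc t (t + ρ) ∪ (A ∩ Ioi (t + ρ)) := by
    intro r hr
    rcases le_or_gt r (t + ρ) with h1 | h1
    · exact Or.inl ⟨hAt hr, h1⟩
    · exact Or.inr ⟨hr, h1⟩
  have hfar : ∫⁻ r in A ∩ Ioi (t + ρ), ENNReal.ofReal ((r - t) ^ (1 / q - 1)) ≤
      ENNReal.ofReal (ρ ^ (1 / q)) := by
    calc _ ≤ ∫⁻ _ in A ∩ Ioi (t + ρ), ENNReal.ofReal (ρ ^ (1 / q - 1)) := by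
          refine setLIntegral_mono' (hA.inter measurableSet_Ioi) fun r hr => ?_
          refine ENNReal.ofReal_le_ofReal (Real.rpow_le_rpow_of_nonpos hρ0 ?_ (by linarith))
          have := mem_Ioi.1 hr.2
          linarith
      _ ≤ ENNReal.ofReal (ρ ^ (1 / q - 1)) * ENNReal.ofReal ρ := by
          rw [setLIntegral_const, ← hAρ]
          gcongr
          exact inter_subset_left
      _ = _ := by
          rw [← ENNReal.ofReal_mul (by positivity)]
          congr 1
          nth_rw 2 [← Real.rpow_one ρ]
          rw [← Real.rpow_add hρ0]
          congr 1
          ring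
  have hnear := lintegral_Ioc_rpow_sub (b := 1 / q - 1) (by linarith) t hρ0.le
  calc _ ≤ _ := lintegral_mono_set hsub
    _ ≤ _ := lintegral_union_le _ _ _
    _ ≤ ENNReal.ofReal (q * ρ ^ (1 / q)) + ENNReal.ofReal (ρ ^ (1 / q)) := by
        gcongr
        rw [hnear]
        apply le_of_eq
        congr 1
        rw [sub_add_cancel]
        field_simp
    _ = _ := by
        rw [hAρ, ENNReal.ofReal_rpow_of_pos hρ0, ← ENNReal.ofReal_mul (by positivity),
          ← ENNReal.ofReal_add (by positivity) (by positivity)]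
        congr 1
        ring

/-- The layer-cake formula for a single value, `∞` included; it reduces Lorentz duality to the
weak-type bound on superlevel sets. -/
lemma lintegral_Ioi_indicator_le (y : ℝ≥0∞) :
    ∫⁻ l in Ioi (0 : ℝ), {l : ℝ | ENNReal.ofReal l ≤ y}.indicator 1 l = y := by
  have hm : MeasurableSet {l : ℝ | ENNReal.ofReal l ≤ y} :=
    measurableSet_le ENNReal.measurable_ofReal measurable_const
  rw [lintegral_indicator_one hm, Measure.restrict_apply hm]
  rcases eq_or_ne y ∞ with rfl | hy
  · simp
  · have : {l : ℝ | ENNReal.ofReal l ≤ y} ∩ Ioi 0 = Ioc 0 y.toReal := by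
      ext l
      simp only [mem_inter_iff, mem_ofPred_eq, mem_Ioi, mem_Ioc,
        ENNReal.ofReal_le_iff_le_toReal hy, and_comm]
    rw [this, Real.volume_Ioc, sub_zero, ENNReal.ofReal_toReal hy]

/-- Hölder's inequality in Lorentz spaces, for the weight `r ↦ (r - t) ^ (1 / q - 1)`. -/
lemma lintegral_rpow_sub_mul_le {q : ℝ} (hq : 1 < q) {t T : ℝ} (ht : 0 ≤ t) {g : ℝ → ℝ≥0∞}
    (hg : Measurable g) :
    ∫⁻ r in Ioc t T, ENNReal.ofReal ((r - t) ^ (1 / q - 1)) * g r ≤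
      ENNReal.ofReal (q + 1) * ∫⁻ l in Ioi (0 : ℝ),
        volume.restrict (Icc 0 T) {r | ENNReal.ofReal l ≤ g r} ^ (1 / q) := by
  have hw : Measurable fun r : ℝ => ENNReal.ofReal ((r - t) ^ (1 / q - 1)) := by fun_prop
  have hS : MeasurableSet {z : ℝ × ℝ | ENNReal.ofReal z.2 ≤ g z.1} :=
    measurableSet_le (ENNReal.measurable_ofReal.comp measurable_snd) (hg.comp measurable_fst)
  have hSl : ∀ l, MeasurableSet {r | ENNReal.ofReal l ≤ g r} := fun l =>
    measurableSet_le measurable_const hg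
  calc _ = ∫⁻ r in Ioc t T, ∫⁻ l in Ioi (0 : ℝ), ENNReal.ofReal ((r - t) ^ (1 / q - 1)) *
          {z : ℝ × ℝ | ENNReal.ofReal z.2 ≤ g z.1}.indicator 1 (r, l) := by
        refine lintegral_congr fun r => ?_
        rw [lintegral_const_mul]
        · congr 1
          exact (lintegral_Ioi_indicator_le (g r)).symm
        · exact (measurable_one.indicator hS).comp measurable_prodMk_left
    _ = ∫⁻ l in Ioi (0 : ℝ), ∫⁻ r in Ioc t T, ENNReal.ofReal ((r - t) ^ (1 / q - 1)) *
          {z : ℝ × ℝ | ENNReal.ofReal z.2 ≤ g z.1}.indicator 1 (r, l) := by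
        refine lintegral_lintegral_swap (Measurable.aemeasurable ?_)
        exact (hw.comp measurable_fst).mul (measurable_one.indicator hS)
    _ ≤ ∫⁻ l in Ioi (0 : ℝ), ENNReal.ofReal (q + 1) *
          volume.restrict (Icc 0 T) {r | ENNReal.ofReal l ≤ g r} ^ (1 / q) := by
        refine lintegral_mono fun l => ?_
        calc _ = ∫⁻ r in {r | ENNReal.ofReal l ≤ g r} ∩ Ioc t T,
              ENNReal.ofReal ((r - t) ^ (1 / q - 1)) := by
              rw [← Measure.restrict_restrict (hSl l), ← lintegral_indicator (hSl l)]
              refine lintegral_congr fun r => ?_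
              simp only [indicator, mem_ofPred_eq, Pi.one_apply]
              split_ifs <;> simp
          _ ≤ _ := lintegral_rpow_sub_le hq t ((hSl l).inter measurableSet_Ioc)
              fun r hr => hr.2.1
          _ ≤ _ := by
              rw [Measure.restrict_apply (hSl l)]
              gcongr
              exact fun r hr => ⟨ht.trans hr.1.le, hr.2⟩
    _ = _ := lintegral_const_mul' _ _ ENNReal.ofReal_ne_top

/-- For `r = 1` the factor `t` in the quasi-norm cancels the density of `dt / t`. -/
lemma lorentzENorm_one {X : Type*} [MeasurableSpace X] (g : X → ℝ≥0∞) (q : ℝ) (μ : Measure X) :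
    lorentzENorm g q 1 μ = ENNReal.ofReal q *
      ∫⁻ l in Ioi (0 : ℝ), μ {x | ENNReal.ofReal l ≤ g x} ^ (1 / q) := by
  rw [lorentzENorm, eLpNorm_one_eq_lintegral_enorm, haarHalfLine,
    lintegral_withDensity_eq_lintegral_mul_non_measurable _ (by fun_prop)]
  · simp only [ENNReal.toReal_one, div_one, ENNReal.rpow_one, enorm_eq_self, Pi.mul_apply]
    congr 1
    refine setLIntegral_congr_fun measurableSet_Ioi fun l hl => ?_
    have hl : 0 < l := hl
    rw [← mul_assoc, ← ENNReal.ofReal_mul (by positivity), inv_mul_cancel₀ hl.ne']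
    simp
  · exact Filter.Eventually.of_forall fun l => ENNReal.ofReal_lt_top

lemma measurable_measure_superlevel_rpow {X : Type*} [MeasurableSpace X] (g : X → ℝ≥0∞) {a : ℝ}
    (ha : 0 ≤ a) (μ : Measure X) : Measurable fun l => μ {x | ENNReal.ofReal l ≤ g x} ^ a := by
  refine Antitone.measurable fun l l' h => ?_
  refine ENNReal.rpow_le_rpow (measure_mono fun x hx => ?_) ha
  exact (ENNReal.ofReal_le_ofReal h).trans hx

/-! ### Absolute continuity of the norms under truncation -/

section Truncation

variable {X : Type*} [MeasurableSpace X] {μ : Measure X} {a : ℝ}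

/-- Every superlevel set contains `{g = ∞}`; if that set had positive measure, the integrand would
be bounded below on a half line of infinite length. -/
lemma ae_lt_top_of_lintegral_superlevel {g : X → ℝ≥0∞} (ha : 0 < a)
    (hfin : ∫⁻ l in Ioi (0 : ℝ), μ {x | ENNReal.ofReal l ≤ g x} ^ a ≠ ∞) :
    ∀ᵐ x ∂μ, g x ≠ ∞ := by
  by_contra hcon
  apply hfin
  have h0 : μ {x | g x = ∞} ≠ 0 := by
    intro h
    exact hcon (by simpa [ae_iff] using h)
  refine top_le_iff.1 ?_
  calc ∞ = ∫⁻ _ in Ioi (0 : ℝ), μ {x | g x = ∞} ^ a := by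
        rw [setLIntegral_const, Real.volume_Ioi, ENNReal.mul_top]
        rw [Ne, ENNReal.rpow_eq_zero_iff]
        rintro (h | h)
        · exact h0 h.1
        · linarith [h.2]
    _ ≤ _ := by
        refine lintegral_mono fun l => ?_
        gcongr with x
        intro h
        rw [h]
        exact le_top

/-- For each level `l > 0` the superlevel sets decrease to a null set, so their measures tend to `0`
by finiteness of `μ`; dominated convergence in `l`, with the profile of `g` as majorant, concludes.
-/
lemma tendsto_lintegral_superlevel_of_antitone [IsFiniteMeasure μ] {g : X → ℝ≥0∞}
    {gM : ℕ → X → ℝ≥0∞} (ha : 0 < a) (hgM : ∀ M, Measurable (gM M)) (hanti : Antitone gM)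
    (hle : ∀ M, gM M ≤ g)
    (hfin : ∫⁻ l in Ioi (0 : ℝ), μ {x | ENNReal.ofReal l ≤ g x} ^ a ≠ ∞)
    (hlim : ∀ᵐ x ∂μ, Filter.Tendsto (fun M => gM M x) Filter.atTop (nhds 0)) :
    Filter.Tendsto (fun M => ∫⁻ l in Ioi (0 : ℝ), μ {x | ENNReal.ofReal l ≤ gM M x} ^ a)
      Filter.atTop (nhds 0) := by
  have h0 : (0 : ℝ≥0∞) = ∫⁻ _ in Ioi (0 : ℝ), 0 := by simp
  rw [h0]
  refine tendsto_lintegral_of_dominated_convergence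
    (fun l => μ {x | ENNReal.ofReal l ≤ g x} ^ a)
    (fun M => measurable_measure_superlevel_rpow _ ha.le μ) (fun M => ?_) hfin ?_
  · refine Filter.Eventually.of_forall fun l => ?_
    refine ENNReal.rpow_le_rpow (measure_mono fun x hx => ?_) ha.le
    exact le_trans hx (hle M x)
  · refine (ae_restrict_mem measurableSet_Ioi).mono fun l hl => ?_
    have hl : 0 < l := hl
    have h1 : Filter.Tendsto (fun M => μ {x | ENNReal.ofReal l ≤ gM M x}) Filter.atTop
        (nhds (μ (⋂ M, {x | ENNReal.ofReal l ≤ gM M x}))) := by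
      refine tendsto_measure_iInter_atTop
        (fun M => (measurableSet_le measurable_const (hgM M)).nullMeasurableSet)
        (fun M M' h x hx => ?_) ⟨0, measure_ne_top _ _⟩
      exact le_trans hx (hanti h x)
    have h2 : μ (⋂ M, {x | ENNReal.ofReal l ≤ gM M x}) = 0 := by
      refine measure_mono_null (fun x hx => ?_) (ae_iff.1 hlim)
      intro hcon
      have := ge_of_tendsto' hcon (mem_iInter.1 hx)
      simp at this
      linarith
    rw [h2] at h1
    have h3 := (ENNReal.continuous_rpow_const (y := a)).tendsto 0 |>.comp h1
    rwa [ENNReal.zero_rpow_of_pos ha] at h3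

lemma tendsto_lintegral_truncation {F : X → ℝ≥0∞} (hF : Measurable F) (hF' : ∀ x, F x ≠ ∞)
    (ha : 0 < a) (hfin : ∫⁻ x, F x ^ a ∂μ ≠ ∞) :
    Filter.Tendsto (fun M : ℕ => ∫⁻ x, ({x | (M : ℝ≥0∞) < F x}.indicator F x) ^ a ∂μ)
      Filter.atTop (nhds 0) := by
  have h0 : (0 : ℝ≥0∞) = ∫⁻ _, 0 ∂μ := by simp
  rw [h0]
  refine tendsto_lintegral_of_dominated_convergence (fun x => F x ^ a)
    (fun M => (hF.indicator (measurableSet_lt measurable_const hF)).pow_const a) (fun M => ?_)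
    hfin ?_
  · refine Filter.Eventually.of_forall fun x => ?_
    exact ENNReal.rpow_le_rpow (indicator_le_self _ _ _) ha.le
  · refine Filter.Eventually.of_forall fun x => ?_
    obtain ⟨N, hN⟩ := ENNReal.exists_nat_gt (hF' x)
    refine tendsto_const_nhds.congr' ?_
    filter_upwards [Filter.eventually_ge_atTop N] with M hM
    have : x ∉ {x | (M : ℝ≥0∞) < F x} := by
      simp only [mem_ofPred_eq, not_lt]
      exact hN.le.trans (by exact_mod_cast hM)
    rw [indicator_of_notMem this, ENNReal.zero_rpow_of_pos ha]

end Truncation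

/-! ### Application to mixed Lorentz functions -/

section MixedLorentz

variable {d : ℕ}

/-- A set that is null for the space-time Lebesgue measure is a.s. not charged by a Brownian
path. -/
lemma IsContBrownian.ae_ae_of_ae_prod {Ω : Type*} [MeasurableSpace Ω]
    {x : EuclideanSpace ℝ (Fin d)} {B : ℝ≥0 → Ω → EuclideanSpace ℝ (Fin d)} {P : Measure Ω}
    (hB : IsContBrownian x B P) {T : ℝ} {p : ℝ × EuclideanSpace ℝ (Fin d) → Prop}
    (h : ∀ᵐ z ∂((volume.restrict (Icc (0 : ℝ) T)).prod volume), p z) :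
    ∀ᵐ ω ∂P, ∀ᵐ r ∂(volume.restrict (Ioc (0 : ℝ) T)), p (r, B r.toNNReal ω) := by
  have := hB.isProbabilityMeasure
  set μ := (volume.restrict (Icc (0 : ℝ) T)).prod (volume : Measure (EuclideanSpace ℝ (Fin d)))
    with hμ
  set N := toMeasurable μ {z | ¬ p z} with hN
  have hNm : MeasurableSet N := measurableSet_toMeasurable _ _
  have hN0 : μ N = 0 := by rw [hN, measure_toMeasurable]; exact h
  have hp : ∀ z, z ∉ N → p z := fun z hz => by
    by_contra hcon
    exact hz (subset_toMeasurable _ _ hcon)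
  have h1 : ∀ᵐ r ∂(volume.restrict (Ioc (0 : ℝ) T)),
      volume (Prod.mk r ⁻¹' N : Set (EuclideanSpace ℝ (Fin d))) = 0 :=
    ae_mono (Measure.restrict_mono Ioc_subset_Icc_self le_rfl)
      ((Measure.measure_prod_null hNm).1 hN0)
  have hmeas : Measurable fun z : Ω × ℝ => (z.2, B z.2.toNNReal z.1) :=
    measurable_snd.prodMk (hB.measurable_uncurry.comp
      (measurable_snd.real_toNNReal.prodMk measurable_fst))
  have h2 : ∀ᵐ r ∂(volume.restrict (Ioc (0 : ℝ) T)), ∀ᵐ ω ∂P, (r, B r.toNNReal ω) ∉ N := by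
    filter_upwards [h1, ae_restrict_mem measurableSet_Ioc] with r hr hr0
    -- Time `0` is excluded because the law there is a point mass; at positive times it is dominated
    -- by Lebesgue measure.
    have hr' : r.toNNReal ≠ 0 := by simpa using hr0.1
    have h3 : P.map (B r.toNNReal) (Prod.mk r ⁻¹' N) = 0 := by
      refine le_antisymm ((hB.map_le hr' _).trans ?_) zero_le
      rw [Measure.smul_apply, hr, smul_zero]
    rw [Measure.map_apply (hB.measurable _) (measurable_prodMk_left hNm)] at h3
    exact measure_eq_zero_iff_ae_notMem.1 h3
  have h4 := (Measure.ae_ae_comm (μ := P) (ν := volume.restrict (Ioc (0 : ℝ) T))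
    (p := fun ω r => (r, B r.toNNReal ω) ∉ N) (hmeas hNm).compl).2 h2
  filter_upwards [h4] with ω hω
  filter_upwards [hω] with r hr using hp _ hr

/-- A function in `L^{q,1}([0, T], L^p)` agrees a.e. with a jointly measurable one with the same
mixed Lorentz bound, written with integrals. -/
lemma MemMixedLorentz.exists_measurable {f : ℝ → EuclideanSpace ℝ (Fin d) → ℝ} {p q T : ℝ}
    (hp : 1 < p) (hq : 1 < q) (hf : MemMixedLorentz f q 1 p T) :
    ∃ F : ℝ × EuclideanSpace ℝ (Fin d) → ℝ, Measurable F ∧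
      (∀ᵐ z ∂((volume.restrict (Icc (0 : ℝ) T)).prod volume), f z.1 z.2 = F z) ∧
      ∫⁻ l in Ioi (0 : ℝ), volume.restrict (Icc 0 T)
        {r | ENNReal.ofReal l ≤ (∫⁻ y, ‖F (r, y)‖ₑ ^ p) ^ (1 / p)} ^ (1 / q) ≠ ∞ := by
  have hp0 : 0 < p := by linarith
  refine ⟨hf.aemeasurable.mk, hf.aemeasurable.measurable_mk, hf.aemeasurable.ae_eq_mk, ?_⟩
  set F := hf.aemeasurable.mk (Function.uncurry f)
  have h1 := hf.lorentzENorm_lt_top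
  rw [lorentzENorm_one] at h1
  have h2 : ∀ᵐ r ∂(volume.restrict (Icc (0 : ℝ) T)),
      eLpNorm (f r) (ENNReal.ofReal p) volume = (∫⁻ y, ‖F (r, y)‖ₑ ^ p) ^ (1 / p) := by
    filter_upwards [Measure.ae_ae_of_ae_prod hf.aemeasurable.ae_eq_mk] with r hr
    rw [eLpNorm_congr_ae (f := f r) (g := fun y => F (r, y)) hr, eLpNorm_eq_lintegral_rpow_enorm_toReal
      (by simpa using hp0) ENNReal.ofReal_ne_top, ENNReal.toReal_ofReal hp0.le]
  have h3 : ∀ l : ℝ, volume.restrict (Icc (0 : ℝ) T)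
        {r | ENNReal.ofReal l ≤ eLpNorm (f r) (ENNReal.ofReal p) volume} =
      volume.restrict (Icc (0 : ℝ) T)
        {r | ENNReal.ofReal l ≤ (∫⁻ y, ‖F (r, y)‖ₑ ^ p) ^ (1 / p)} := by
    intro l
    refine measure_congr ?_
    filter_upwards [h2] with r hr
    change (_ ≤ _) = (_ ≤ _)
    rw [hr]
  simp only [h3] at h1
  intro hcon
  rw [hcon, ENNReal.mul_top (by simp; linarith)] at h1
  exact lt_irrefl _ h1

/-- The large values of a function in `L^{q,1}([0, T], L^p)` satisfy Khasminskii's condition. -/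
lemma exists_truncation_khasminskii {F : ℝ × EuclideanSpace ℝ (Fin d) → ℝ} {p q T : ℝ}
    (hp : 1 < p) (hq : 1 < q) (hpq : 2 / q + (d : ℝ) / p = 2) (hF : Measurable F)
    (hfin : ∫⁻ l in Ioi (0 : ℝ), volume.restrict (Icc 0 T)
        {r | ENNReal.ofReal l ≤ (∫⁻ y, ‖F (r, y)‖ₑ ^ p) ^ (1 / p)} ^ (1 / q) ≠ ∞) :
    ∃ M : ℕ, ∀ {Ω : Type*} [MeasurableSpace Ω] (P : Measure Ω), ∀ t, 0 ≤ t → ∀ x,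
      ∀ B : ℝ≥0 → Ω → EuclideanSpace ℝ (Fin d), IsContBrownian x B P →
      ∫⁻ r in Ioc t T, ∫⁻ ω, {z | (M : ℝ≥0∞) < ‖F z‖ₑ}.indicator (fun z => ‖F z‖ₑ)
        (r, B (r - t).toNNReal ω) ∂P ≤ 2⁻¹ := by
  have hp0 : 0 < p := by linarith
  have hq0 : 0 < q := by linarith
  let H : ℕ → ℝ × EuclideanSpace ℝ (Fin d) → ℝ≥0∞ := fun M =>
    {z | (M : ℝ≥0∞) < ‖F z‖ₑ}.indicator fun z => ‖F z‖ₑ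
  have hH : ∀ M, Measurable (H M) := fun M =>
    hF.enorm.indicator (measurableSet_lt measurable_const hF.enorm)
  let g : ℝ → ℝ≥0∞ := fun r => (∫⁻ y, ‖F (r, y)‖ₑ ^ p) ^ (1 / p)
  let gM : ℕ → ℝ → ℝ≥0∞ := fun M r => (∫⁻ y, H M (r, y) ^ p) ^ (1 / p)
  have hgM : ∀ M, Measurable (gM M) := fun M =>
    (((hH M).pow_const p).lintegral_prod_right').pow_const _
  have hanti : Antitone gM := by
    intro M M' h r
    simp only [gM]
    gcongr with y
    refine indicator_le_indicator_of_subset (fun z hz => ?_) (fun _ => zero_le) _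
    exact lt_of_le_of_lt (Nat.cast_le.2 h) (mem_ofPred_eq ▸ hz)
  have hle : ∀ M, gM M ≤ g := by
    intro M r
    simp only [gM, g]
    gcongr with y
    exact indicator_le_self _ _ _
  have hlim : ∀ᵐ r ∂(volume.restrict (Icc (0 : ℝ) T)),
      Filter.Tendsto (fun M => gM M r) Filter.atTop (nhds 0) := by
    filter_upwards [ae_lt_top_of_lintegral_superlevel (by positivity) hfin] with r hr
    have h1 : ∫⁻ y, ‖F (r, y)‖ₑ ^ p ≠ ∞ := by
      intro hcon
      rw [hcon, ENNReal.top_rpow_of_pos (by positivity)] at hr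
      exact hr rfl
    have h2 := tendsto_lintegral_truncation (μ := volume) (F := fun y => ‖F (r, y)‖ₑ)
      (hF.enorm.comp measurable_prodMk_left) (fun y => enorm_ne_top) hp0 h1
    have h3 := (ENNReal.continuous_rpow_const (y := 1 / p)).tendsto 0 |>.comp h2
    rwa [ENNReal.zero_rpow_of_pos (by positivity)] at h3
  have htend := tendsto_lintegral_superlevel_of_antitone (a := 1 / q) (by positivity) hgM hanti hle
    hfin hlim
  have htend' := ENNReal.Tendsto.const_mul htend
    (Or.inr (ENNReal.ofReal_ne_top (r := q + 1)))
  rw [mul_zero] at htend'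
  -- Any constant in `(0, 1)` would serve as Khasminskii's `α`; `2⁻¹` yields the final factor `2`.
  obtain ⟨M, hM⟩ := (htend'.eventually_le_const (u := 2⁻¹) (by simp)).exists
  refine ⟨M, fun P t ht x B hB => ?_⟩
  -- The scaling relation makes the heat kernel exponent critical for `L^{q,1}`.
  have hexp : -((d : ℝ) / p / 2) = 1 / q - 1 := by
    have : 2 / q = 2 * (1 / q) := by ring
    linarith
  calc _ ≤ ∫⁻ r in Ioc t T, ENNReal.ofReal ((r - t) ^ (1 / q - 1)) * gM M r := by
        refine setLIntegral_mono' measurableSet_Ioc fun r hr => ?_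
        rw [← hexp]
        exact hB.lintegral_comp_le hp ((hH M).comp measurable_prodMk_left) (by linarith [hr.1])
    _ ≤ _ := lintegral_rpow_sub_mul_le hq ht (hgM M)
    _ ≤ _ := hM

/-- Exponential integrability of a path integral of a function whose large values satisfy
Khasminskii's condition. -/
lemma exp_integral_le {Ω : Type*} [MeasurableSpace Ω] {P : Measure Ω}
    {f : ℝ → EuclideanSpace ℝ (Fin d) → ℝ} {F : ℝ × EuclideanSpace ℝ (Fin d) → ℝ} {T : ℝ}
    (hT : 0 ≤ T) (hF : Measurable F)
    (hfF : ∀ᵐ z ∂((volume.restrict (Icc (0 : ℝ) T)).prod volume), f z.1 z.2 = F z) {M : ℕ}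
    (hM : ∀ t, 0 ≤ t → ∀ x, ∀ B : ℝ≥0 → Ω → EuclideanSpace ℝ (Fin d), IsContBrownian x B P →
      ∫⁻ r in Ioc t T, ∫⁻ ω, {z | (M : ℝ≥0∞) < ‖F z‖ₑ}.indicator (fun z => ‖F z‖ₑ)
        (r, B (r - t).toNNReal ω) ∂P ≤ 2⁻¹)
    {x : EuclideanSpace ℝ (Fin d)} {B : ℝ≥0 → Ω → EuclideanSpace ℝ (Fin d)}
    (hB : IsBrownianFrom x B P) :
    (∀ᵐ ω ∂P, IntervalIntegrable (fun s : ℝ => f s (B s.toNNReal ω)) volume 0 T) ∧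
    AEMeasurable (fun ω => ∫ s in (0 : ℝ)..T, f s (B s.toNNReal ω)) P ∧
    ∫⁻ ω, ENNReal.ofReal (Real.exp (∫ s in (0 : ℝ)..T, f s (B s.toNNReal ω))) ∂P ≤
      ENNReal.ofReal (Real.exp (M * T)) * 2 := by
  obtain ⟨B', hB', hBB'⟩ := hB.exists_isContBrownian
  let H : ℝ → EuclideanSpace ℝ (Fin d) → ℝ≥0∞ := fun r y =>
    {z | (M : ℝ≥0∞) < ‖F z‖ₑ}.indicator (fun z => ‖F z‖ₑ) (r, y)
  have hH : Measurable (Function.uncurry H) :=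
    hF.enorm.indicator (measurableSet_lt measurable_const hF.enorm)
  have hFH : ∀ r y, ‖F (r, y)‖ₑ ≤ M + H r y := by
    intro r y
    simp only [H, indicator, mem_ofPred_eq]
    split_ifs with h
    · exact le_add_self
    · simpa using h
  obtain ⟨hYfin, hYexp⟩ := khasminskii_exp (P := P) hH (T := T) (α := 2⁻¹) (by simp) hM hB'
  have hFm : Measurable fun z : Ω × ℝ => F (z.2, B' z.2.toNNReal z.1) :=
    hF.comp (measurable_snd.prodMk (hB'.measurable_uncurry.comp
      (measurable_snd.real_toNNReal.prodMk measurable_fst)))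
  have hae : ∀ᵐ ω ∂P, (fun s => f s (B s.toNNReal ω)) =ᵐ[volume.restrict (Ioc (0 : ℝ) T)]
      fun s => F (s, B' s.toNNReal ω) := by
    filter_upwards [hBB', hB'.ae_ae_of_ae_prod hfF] with ω h1 h2
    filter_upwards [h2] with s hs
    rw [h1, hs]
  have hbound : ∀ ω, ∫⁻ s in Ioc 0 T, ‖F (s, B' s.toNNReal ω)‖ₑ ≤
      ENNReal.ofReal (M * T) + ∫⁻ s in Ioc 0 T, H s (B' s.toNNReal ω) := by
    intro ω
    calc _ ≤ ∫⁻ s in Ioc 0 T, (M + H s (B' s.toNNReal ω)) := lintegral_mono fun s => hFH _ _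
      _ = _ := by
        rw [lintegral_add_left measurable_const, setLIntegral_const, Real.volume_Ioc, sub_zero,
          ENNReal.ofReal_mul (by positivity), ENNReal.ofReal_natCast]
  have hint : ∀ᵐ ω ∂P, IntegrableOn (fun s => F (s, B' s.toNNReal ω)) (Ioc 0 T) := by
    filter_upwards [hYfin] with ω hω
    refine ⟨(hFm.comp measurable_prodMk_left).aestronglyMeasurable, ?_⟩
    exact lt_of_le_of_lt (hbound ω) (ENNReal.add_lt_top.2 ⟨ENNReal.ofReal_lt_top, hω.lt_top⟩)
  have hinteq : ∀ᵐ ω ∂P, ∫ s in (0 : ℝ)..T, f s (B s.toNNReal ω) =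
      ∫ s in Ioc 0 T, F (s, B' s.toNNReal ω) := by
    filter_upwards [hae] with ω hω
    rw [intervalIntegral.integral_of_le hT]
    exact integral_congr_ae hω
  refine ⟨?_, ?_, ?_⟩
  · filter_upwards [hae, hint] with ω h1 h2
    exact (intervalIntegrable_iff_integrableOn_Ioc_of_le hT).2 (h2.congr h1.symm)
  · refine ⟨fun ω => ∫ s in Ioc 0 T, F (s, B' s.toNNReal ω), ?_, hinteq⟩
    exact (hFm.stronglyMeasurable.integral_prod_right' (ν := volume.restrict (Ioc 0 T))).measurable
  · calc _ ≤ ∫⁻ ω, ENNReal.ofReal (Real.exp (M * T)) * ENNReal.ofReal (Real.exp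
          (∫⁻ s in Ioc 0 T, H s (B' s.toNNReal ω)).toReal) ∂P := by
          refine lintegral_mono_ae ?_
          filter_upwards [hinteq, hYfin] with ω h1 h2
          rw [h1, ← ENNReal.ofReal_mul (by positivity), ← Real.exp_add]
          refine ENNReal.ofReal_le_ofReal (Real.exp_le_exp.2 ?_)
          calc _ ≤ ‖∫ s in Ioc 0 T, F (s, B' s.toNNReal ω)‖ := Real.le_norm_self _
            _ ≤ (∫⁻ s in Ioc 0 T, ENNReal.ofReal ‖F (s, B' s.toNNReal ω)‖).toReal :=
              norm_integral_le_lintegral_norm _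
            _ ≤ (ENNReal.ofReal (M * T) + ∫⁻ s in Ioc 0 T, H s (B' s.toNNReal ω)).toReal := by
              refine ENNReal.toReal_mono (ENNReal.add_ne_top.2 ⟨ENNReal.ofReal_ne_top, h2⟩) ?_
              simpa only [ofReal_norm] using hbound ω
            _ = _ := by
              rw [ENNReal.toReal_add ENNReal.ofReal_ne_top h2,
                ENNReal.toReal_ofReal (by positivity)]
      _ = ENNReal.ofReal (Real.exp (M * T)) * ∫⁻ ω, ENNReal.ofReal (Real.exp
          (∫⁻ s in Ioc 0 T, H s (B' s.toNNReal ω)).toReal) ∂P :=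
          lintegral_const_mul' _ _ ENNReal.ofReal_ne_top
      _ ≤ _ := by
          gcongr
          refine hYexp.trans ?_
          rw [ENNReal.one_sub_inv_two, inv_inv]

end MixedLorentz

theorem proposition2p3 {d : ℕ} {p q T : ℝ} (hp : 1 < p) (hq : 1 < q) (hT : 0 ≤ T)
    (hpq : 2 / q + (d : ℝ) / p = 2)
    (f : ℝ → EuclideanSpace ℝ (Fin d) → ℝ) (hf : MemMixedLorentz f q 1 p T)
    (Ω : EuclideanSpace ℝ (Fin d) → Type*) [∀ x, MeasurableSpace (Ω x)]
    (P : ∀ x, Measure (Ω x)) (B : ∀ x, ℝ≥0 → Ω x → EuclideanSpace ℝ (Fin d))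
    (hB : ∀ x, IsBrownianFrom x (B x) (P x)) :
    (∀ x, ∀ᵐ ω ∂(P x),
      IntervalIntegrable (fun s : ℝ => f s (B x s.toNNReal ω)) volume 0 T) ∧
    (∀ x, AEMeasurable (fun ω => ∫ s in (0 : ℝ)..T, f s (B x s.toNNReal ω)) (P x)) ∧
    (⨆ x, ∫⁻ ω, ENNReal.ofReal (Real.exp (∫ s in (0 : ℝ)..T, f s (B x s.toNNReal ω))) ∂(P x) :
      ℝ≥0∞) < ∞ := by
  obtain ⟨F, hF, hfF, hfin⟩ := hf.exists_measurable hp hq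
  obtain ⟨M, hM⟩ := exists_truncation_khasminskii hp hq hpq hF hfin
  -- `M` was chosen before the probability space and the starting point, so one bound serves every
  -- `x`.
  have h := fun x => exp_integral_le hT hF hfF (hM (P x)) (hB x)
  refine ⟨fun x => (h x).1, fun x => (h x).2.1, lt_of_le_of_lt (iSup_le fun x => (h x).2.2) ?_⟩
  exact ENNReal.mul_lt_top ENNReal.ofReal_lt_top (by simp)
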